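/- Let $A$ be a $d\times n$ integer matrix of rank $d=n-2$ with columns $a_1,\dots,a_n\in\mathbb Z^{d}$ and with $(1,\dots,1)$ in its row space over $\mathbb Q$, so that $A$ defines a projective toric variety $X_A\subset\mathbb P^{n-1}$ of codimension $2$, and let $P=\mathrm{Conv}(A)$ be the convex hull of the columns of $A$. Let $B$ be a Gale dual of $A$, i.e. an $n\times 2$ integer matrix whose image in $\mathbb Z^n$ is $\ker(A)\cap\mathbb Z^n$, and assume that all rows $b_1,\dots,b_n\in\mathbb Z^2$ of $B$ are non-zero. For faces $\beta\subset\alpha$ of $P$ let $\mathbb Z\alpha$ be the lattice spanned by the columns $a_i\in\alpha$, let $\mathbb R\beta$ be the linear subspace of $\mathbb R^d$ spanned by $\beta$, and put $i(\alpha,\beta)=[\mathbb Z\alpha\cap\mathbb R\beta:\mathbb Z\beta]$. Let $A_\alpha/\beta$ be the image of $\{a_i : a_i\in\alpha\}$ in the lattice $M=\mathbb Z\alpha/(\mathbb Z\alpha\cap\mathbb R\beta)$, and put $$\mu(\alpha,\beta)=\mathrm{Vol}(\mathrm{Conv}(A_\alpha/\beta))-\mathrm{Vol}(\mathrm{Conv}(A_\alpha/\beta\setminus\{0\})),$$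 where $\mathrm{Vol}$ is the $\mathrm{rank}(M)$-dimensional volume, normalized so that a unimodular simplex of $M$ has volume $1$. A line through $0$ in $\mathbb R^2$ is called relevant if it contains two rows $b_r,b_s$ of $B$ that point in opposite directions. A vector of $\mathbb Z^2$ is called primitive if it is not a multiple $c\,w$ of an integer vector $w$ with an integer $c\neq\pm1$. Let $\beta$ be a proper face of $P$ and let $\mathfrak I_\beta=\{i : a_i\notin\beta\}$. Assume that all $b_i$ with $i\in\mathfrak I_\beta$ lie on one relevant line, let $v\in\mathbb Z^2$ be a primitive vector on that line, and write $b_i=\lambda_i v$ with $\lambda_i\in\mathbb Z$ for $i\in\mathfrak I_\beta$. Then $$\mu(P,\beta)=\frac{\min\Bigl(\sum_{i\in\mathfrak I_\beta,\ \lambda_i>0}|\lambda_i|,\ \sum_{i\in\mathfrak I_\beta,\ \lambda_i<0}|\lambda_i|\Bigr)}{\gcd(\lambda_i)_{i\in\mathfrak I_\beta}}\qquad\text{and}\qquad i(P,\beta)=\gcd(\lambda_i)_{i\in\mathfrak I_\beta}.$$ -/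

import Mathlib

namespace ToricGale

/-- The `j`-th column `a_j` of the integer matrix `A`, as a point of `ℝ^d`. -/
def realCol {d n : ℕ} (A : Matrix (Fin d) (Fin n) ℤ) (j : Fin n) : Fin d → ℝ :=
  fun i => (A i j : ℝ)

/-- The polytope `Conv(A) ⊆ ℝ^d`, the convex hull of the columns of `A`. -/
def polytope {d n : ℕ} (A : Matrix (Fin d) (Fin n) ℤ) : Set (Fin d → ℝ) :=
  convexHull ℝ (Set.range (realCol A))

/-- `A` is a `d × n` integer matrix of rank `d` whose rational row space contains `(1, …, 1)`.
Such a matrix defines a projective toric variety `X_A ⊆ ℙ^(n-1)` of dimension `d - 1`, hence of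
codimension `n - d`. -/
structure IsToricMatrix {d n : ℕ} (A : Matrix (Fin d) (Fin n) ℤ) : Prop where
  rank_eq : (A.map (fun z : ℤ => (z : ℚ))).rank = d
  ones_mem_rowSpace : ∃ c : Fin d → ℚ, ∀ j, ∑ i, c i * (A i j : ℚ) = 1

/-- `B` is a Gale dual of `A`: the image of `B : ℤ^k → ℤ^n` is the kernel of `A : ℤ^n → ℤ^d`. -/
def IsGaleDual {d n k : ℕ} (A : Matrix (Fin d) (Fin n) ℤ) (B : Matrix (Fin n) (Fin k) ℤ) : Prop :=
  LinearMap.range B.mulVecLin = LinearMap.ker A.mulVecLin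

/-- The `i`-th row `b_i` of `B`, as a vector of `ℝ^k`. -/
def realRow {n k : ℕ} (B : Matrix (Fin n) (Fin k) ℤ) (i : Fin n) : Fin k → ℝ :=
  fun j => (B i j : ℝ)

/-- A line through `0` in `ℝ^2` is relevant if it contains two rows `b_r`, `b_s` of `B` that point
in opposite directions. -/
def IsRelevantLine {n : ℕ} (B : Matrix (Fin n) (Fin 2) ℤ) (L : Submodule ℝ (Fin 2 → ℝ)) : Prop :=
  Module.finrank ℝ L = 1 ∧
    ∃ r s : Fin n, realRow B r ∈ L ∧ realRow B s ∈ L ∧ realRow B r ≠ 0 ∧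
      ∃ c : ℝ, c < 0 ∧ realRow B s = c • realRow B r

/-- An integer vector is primitive if it is not a nontrivial integer multiple of an integer
vector. -/
def IsPrimitive {k : ℕ} (v : Fin k → ℤ) : Prop :=
  ∀ (c : ℤ) (w : Fin k → ℤ), v = c • w → c = 1 ∨ c = -1

/-- The index set of the rows of `B_β`: those `j` for which the column `a_j` is not in `β`. -/
noncomputable def offFace {d n : ℕ} (A : Matrix (Fin d) (Fin n) ℤ) (β : Set (Fin d → ℝ)) :
    Finset (Fin n) :=
  open scoped Classical in Finset.univ.filter (fun j => realCol A j ∉ β)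

/-- The lattice `ℤα` spanned by the columns of `A` that lie in `α`. -/
def latticeSpan {d n : ℕ} (A : Matrix (Fin d) (Fin n) ℤ) (α : Set (Fin d → ℝ)) :
    Submodule ℤ (Fin d → ℤ) :=
  Submodule.span ℤ {x | ∃ j, realCol A j ∈ α ∧ x = A.col j}

/-- The coordinatewise inclusion `ℤ^d → ℝ^d`. -/
def castPi (d : ℕ) : (Fin d → ℤ) →ₗ[ℤ] (Fin d → ℝ) where
  toFun x := fun i => (x i : ℝ)
  map_add' x y := by ext i; simp
  map_smul' c x := by ext i; simp

/-- The integer points of the linear subspace `ℝβ` of `ℝ^d` spanned by `β`. -/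
def realSpan {d : ℕ} (β : Set (Fin d → ℝ)) : Submodule ℤ (Fin d → ℤ) :=
  ((Submodule.span ℝ β).restrictScalars ℤ).comap (castPi d)

/-- The index `i(α, β) = [ℤα ∩ ℝβ : ℤβ]`. -/
noncomputable def latticeIndex {d n : ℕ} (A : Matrix (Fin d) (Fin n) ℤ)
    (α β : Set (Fin d → ℝ)) : ℕ :=
  (latticeSpan A β).toAddSubgroup.relIndex (latticeSpan A α ⊓ realSpan β).toAddSubgroup

/-- The quotient lattice `ℤα / (ℤα ∩ ℝβ)`. -/
abbrev QuotientLattice {d n : ℕ} (A : Matrix (Fin d) (Fin n) ℤ) (α β : Set (Fin d → ℝ)) : Type :=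
  latticeSpan A α ⧸ (realSpan β).submoduleOf (latticeSpan A α)

instance quotientLattice_free {d n : ℕ} (A : Matrix (Fin d) (Fin n) ℤ) (α β : Set (Fin d → ℝ)) :
    Module.Free ℤ (QuotientLattice A α β) := by
  have : Module.IsTorsionFree ℤ (QuotientLattice A α β) := by
    refine .of_smul_eq_zero fun c x h => ?_
    obtain ⟨y, rfl⟩ := Submodule.Quotient.mk_surjective _ x
    rw [← Submodule.Quotient.mk_smul, Submodule.Quotient.mk_eq_zero] at h
    by_cases hc : c = 0
    · exact Or.inl hc
    · right
      rw [Submodule.Quotient.mk_eq_zero]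
      have h' : (c : ℝ) • castPi d (y : Fin d → ℤ) ∈ Submodule.span ℝ β := by
        have h2 : castPi d (c • (y : Fin d → ℤ)) ∈ Submodule.span ℝ β := h
        rwa [map_smul, ← Int.cast_smul_eq_zsmul ℝ] at h2
      exact ((Submodule.span ℝ β).smul_mem_iff (Int.cast_ne_zero.mpr hc)).mp h'
  infer_instance

/-- The normalized volume of the convex hull of a set `S` of points of a lattice `M` of rank `r`:
`r!` times the Lebesgue measure of the convex hull in `M ⊗ ℝ ≅ ℝ^r`, where the identification is
made by a basis of `M`. A unimodular simplex has normalized volume `1`, and the choice of the basis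
does not matter, since base changes have determinant `±1`. -/
noncomputable def normalizedVolume (M : Type) [AddCommGroup M] [Module.Free ℤ M]
    [Module.Finite ℤ M] (S : Set M) : ℝ :=
  (Module.finrank ℤ M).factorial *
    (MeasureTheory.volume (convexHull ℝ
      ((fun (x : M) (i : Fin (Module.finrank ℤ M)) =>
        (((Module.finBasis ℤ M).repr x i : ℤ) : ℝ)) '' S))).toReal

/-- The set `A_α / β`: the image of the columns of `A` that lie in `α` in the quotient lattice. -/
def quotientPoints {d n : ℕ} (A : Matrix (Fin d) (Fin n) ℤ) (α β : Set (Fin d → ℝ)) :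
    Set (QuotientLattice A α β) :=
  {x | ∃ (j : Fin n) (y : latticeSpan A α), realCol A j ∈ α ∧ (y : Fin d → ℤ) = A.col j ∧
    x = Submodule.Quotient.mk y}

/-- The relative normalized subdiagram volume
`μ(α, β) = Vol(Conv(A_α / β)) - Vol(Conv(A_α / β ∖ {0}))`. -/
noncomputable def subdiagramVolume {d n : ℕ} (A : Matrix (Fin d) (Fin n) ℤ)
    (α β : Set (Fin d → ℝ)) : ℝ :=
  normalizedVolume (QuotientLattice A α β) (quotientPoints A α β) -
    normalizedVolume (QuotientLattice A α β) (quotientPoints A α β \ {0})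

end ToricGale

/-! Let `g` be the gcd of the `λ_i` and `μ = λ/g`. Everything follows from the relations among the
columns off `β`. A relation modulo `ℤβ` extends to an element `By` of `ker A`, whose entries off `β`
are `λ_i (v·y)`. As `v` is primitive, `v·y` takes every integer value, so the relations modulo `ℤβ`
are exactly `ℤλ` (`sum_smul_col_mem_latticeSpan_iff`). Clearing denominators shows that those modulo
`ℝβ` are the saturation `ℤμ` (`sum_smul_col_mem_realSpan_iff`). The index is therefore `[ℤμ : ℤλ] =
g` (`latticeIndex_eq_natAbs`).

The quotient lattice, of rank `r`, is thus generated by `r + 1` nonzero vectors `w_i` whose only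
relation, up to multiples, is `μ`: an integral circuit. Replacing `μ` by `-μ` if necessary, let `∑
μ_i ≤ 0`. Pushing a point of `Conv(0, w)` along `μ` shows that `Conv(0, w)` is `Conv(w)` together
with the simplices on `0` and all `w_j`, `j ≠ i`, one for each `μ_i > 0`, overlapping only in null
sets (`volume_convexHull_insert_zero_circuit`). Such a simplex has normalized volume equal to the
absolute value of a maximal minor, which is `|μ_i|` (`natAbs_det_of_circuit`). The difference of
volumes is the sum of the positive `μ_i`, the smaller of the two sums. -/

open MeasureTheory

/-! ### Volumes of simplices and null sets -/

/-- The simplex `{x ≥ 0, ∑ x ≤ t}` spanned by `0` and `t` times the unit vectors. -/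
def cornerSimplex (ι : Type*) [Fintype ι] (t : ℝ) : Set (ι → ℝ) :=
  {x | 0 ≤ x ∧ ∑ i, x i ≤ t}

lemma isClosed_cornerSimplex (ι : Type*) [Fintype ι] (t : ℝ) : IsClosed (cornerSimplex ι t) :=
  (isClosed_le continuous_const continuous_id).inter
    (isClosed_le (continuous_finsetSum _ fun i _ => continuous_apply i) continuous_const)

lemma isCompact_cornerSimplex (ι : Type*) [Fintype ι] (t : ℝ) : IsCompact (cornerSimplex ι t) := by
  refine (isCompact_Icc (a := (0 : ι → ℝ)) (b := fun _ => t)).of_isClosed_subset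
    (isClosed_cornerSimplex ι t) fun x hx => ⟨hx.1, fun i => ?_⟩
  exact (Finset.single_le_sum (fun j _ => hx.1 j) (Finset.mem_univ i)).trans hx.2

lemma volume_cornerSimplex (r : ℕ) {t : ℝ} (ht : 0 ≤ t) :
    volume (cornerSimplex (Fin r) t) = ENNReal.ofReal (t ^ r / r.factorial) := by
  induction r generalizing t with
  | zero =>
    have : cornerSimplex (Fin 0) t = Set.univ := by
      ext x; simp [cornerSimplex, ht, Subsingleton.elim x 0]
    rw [this, volume_pi, Measure.pi_univ]
    simp
  | succ r ih =>
    let e := MeasurableEquiv.piFinSuccAbove (fun _ : Fin (r + 1) => ℝ) 0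
    have he : MeasurePreserving e.symm :=
      (volume_preserving_piFinSuccAbove (fun _ : Fin (r + 1) => ℝ) 0).symm
    have hm : MeasurableSet (cornerSimplex (Fin (r + 1)) t) :=
      (isClosed_cornerSimplex _ t).measurableSet
    have hfib (s : ℝ) : volume (Prod.mk s ⁻¹' (e.symm ⁻¹' cornerSimplex (Fin (r + 1)) t)) =
        (Set.Icc 0 t).indicator (fun s => ENNReal.ofReal ((t - s) ^ r / r.factorial)) s := by
      have hmem (y : Fin r → ℝ) : y ∈ Prod.mk s ⁻¹' (e.symm ⁻¹' cornerSimplex (Fin (r + 1)) t) ↔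
          (0 ≤ s ∧ 0 ≤ y) ∧ s + ∑ i, y i ≤ t := by
        simp [e, cornerSimplex, Pi.le_def, Fin.forall_fin_succ, Fin.sum_univ_succ,
          MeasurableEquiv.piFinSuccAbove, Fin.insertNthEquiv]
      by_cases hs : s ∈ Set.Icc 0 t
      · rw [Set.indicator_of_mem hs, ← ih (sub_nonneg.2 hs.2)]
        congr 1
        ext y
        rw [hmem, cornerSimplex, Set.mem_ofPred_eq, le_sub_iff_add_le']
        exact and_congr_left' (and_iff_right hs.1)
      · rw [Set.indicator_of_notMem hs, ← measure_empty (μ := (volume : Measure (Fin r → ℝ)))]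
        congr 1
        ext y
        rw [hmem, Set.mem_empty_iff_false, iff_false]
        rintro ⟨⟨h0, hy⟩, hle⟩
        have := Finset.sum_nonneg fun i (_ : i ∈ Finset.univ) => hy i
        exact hs ⟨h0, by linarith⟩
    rw [← he.measure_preimage hm.nullMeasurableSet, Measure.volume_eq_prod,
      Measure.prod_apply (e.symm.measurable hm), lintegral_congr hfib,
      lintegral_indicator measurableSet_Icc, ← ofReal_integral_eq_lintegral_ofReal]
    · congr 1
      rw [integral_Icc_eq_integral_Ioc, ← intervalIntegral.integral_of_le ht,
        intervalIntegral.integral_div,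
        intervalIntegral.integral_comp_sub_left (fun s => s ^ r) t]
      simp [Nat.factorial_succ]
      field_simp
    · exact (Continuous.integrableOn_Icc (by fun_prop))
    · filter_upwards [ae_restrict_mem measurableSet_Icc] with s hs
      have := sub_nonneg.2 hs.2
      positivity

section Circuit

variable {ι : Type*} [Fintype ι] {E : Type*} [AddCommGroup E] [Module ℝ E]

lemma image_cornerSimplex_eq_convexHull (w : ι → E) :
    Fintype.linearCombination ℝ w '' cornerSimplex ι 1 = convexHull ℝ (insert 0 (Set.range w)) := by
  apply subset_antisymm
  · rintro _ ⟨x, hx, rfl⟩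
    have hc := convex_convexHull ℝ (insert 0 (Set.range w))
    have := hc.sum_mem (t := Finset.univ) (w := fun o : Option ι => o.elim (1 - ∑ i, x i) x)
      (z := fun o : Option ι => o.elim 0 w) ?_ ?_ ?_
    · simpa [Fintype.sum_option, Fintype.linearCombination_apply] using this
    · rintro (_ | i) -
      · simpa using hx.2
      · exact hx.1 i
    · simp [Fintype.sum_option]
    · rintro (_ | i) - <;> refine subset_convexHull ℝ _ ?_ <;> simp
  · refine convexHull_min ?_ (Convex.linear_image ?_ _)
    · classical
      rintro _ (rfl | ⟨i, rfl⟩)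
      · exact ⟨0, by simp [cornerSimplex], by simp⟩
      · refine ⟨Pi.single i 1, ⟨by simp, by simp⟩, by simp⟩
    · refine fun x hx y hy a b ha hb hab => ⟨?_, ?_⟩
      · exact add_nonneg (smul_nonneg ha hx.1) (smul_nonneg hb hy.1)
      · simp only [Pi.add_apply, Pi.smul_apply, smul_eq_mul, Finset.sum_add_distrib,
          ← Finset.mul_sum]
        nlinarith [hx.2, hy.2]

lemma image_stdSimplex_eq_convexHull (w : ι → E) :
    Fintype.linearCombination ℝ w '' stdSimplex ℝ ι = convexHull ℝ (Set.range w) := by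
  classical
  rw [← convexHull_basis_eq_stdSimplex, LinearMap.image_convexHull, ← Set.range_comp]
  congr 2
  ext i
  simp [Fintype.linearCombination_apply]

end Circuit

lemma volume_levelSet_eq_zero {r : ℕ} (φ : (Fin r → ℝ) →ₗ[ℝ] ℝ) {c : ℝ} (h : ∃ y, φ y ≠ c) :
    volume {y | φ y = c} = 0 := by
  let s : AffineSubspace ℝ (Fin r → ℝ) := (AffineSubspace.mk' c ⊥).comap φ.toAffineMap
  have hs : (s : Set (Fin r → ℝ)) = {y | φ y = c} := by
    ext y
    simp [s, AffineSubspace.mem_mk', sub_eq_zero]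
  rw [← hs]
  refine Measure.addHaar_affineSubspace _ s fun htop => ?_
  obtain ⟨y, hy⟩ := h
  refine hy ?_
  have : y ∈ (s : Set (Fin r → ℝ)) := by simp [htop]
  rwa [hs] at this

/-- The overlaps between pieces of the circuit decomposition lie in images of this kind. -/
lemma volume_image_levelSet_eq_zero {r : ℕ} (f : (Fin r → ℝ) →ₗ[ℝ] (Fin r → ℝ))
    (φ : (Fin r → ℝ) →ₗ[ℝ] ℝ) {c : ℝ} (h : ∃ y, φ y ≠ c) :
    volume (f '' {y | φ y = c}) = 0 := by
  rw [Measure.addHaar_image_linearMap, volume_levelSet_eq_zero φ h, mul_zero]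

lemma volume_convexHull_insert_zero {r : ℕ} (M : Matrix (Fin r) (Fin r) ℝ) :
    volume (convexHull ℝ (insert 0 (Set.range M.row))) =
      ENNReal.ofReal (|M.det| / r.factorial) := by
  rw [← image_cornerSimplex_eq_convexHull, Measure.addHaar_image_linearMap,
    volume_cornerSimplex r zero_le_one, ← ENNReal.ofReal_mul (abs_nonneg _)]
  have : Fintype.linearCombination ℝ M.row = Matrix.toLin' M.transpose := by
    refine LinearMap.ext fun x => ?_
    rw [Matrix.toLin'_apply, Matrix.mulVec_transpose, Fintype.linearCombination_apply]
    ext j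
    simp [Matrix.vecMul, dotProduct]
  rw [this, LinearMap.det_toLin', Matrix.det_transpose, one_pow, mul_one_div]

/-! ### Decomposing the hull of a real circuit and the origin -/

section Circuit

variable {r : ℕ} {w : Fin (r + 1) → Fin r → ℝ} {μ : Fin (r + 1) → ℝ}

lemma linearCombination_insertNth_zero (w : Fin (r + 1) → Fin r → ℝ) (i : Fin (r + 1))
    (y : Fin r → ℝ) :
    Fintype.linearCombination ℝ w (i.insertNth 0 y) =
      Fintype.linearCombination ℝ (w ∘ i.succAbove) y := by
  simp [Fintype.linearCombination_apply, Fin.sum_univ_succAbove _ i]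

lemma insertNth_zero_removeNth {x : Fin (r + 1) → ℝ} {i : Fin (r + 1)} (hx : x i = 0) :
    i.insertNth (α := fun _ => ℝ) 0 (i.removeNth x) = x := by
  rw [← hx, Fin.insertNth_self_removeNth]

/-- The linear relations of a circuit are the multiples of any nowhere zero relation. -/
lemma exists_eq_add_smul_of_linearCombination_eq
    (hrel : Fintype.linearCombination ℝ w μ = 0) {i : Fin (r + 1)} (hμ : μ i ≠ 0)
    (hli : LinearIndependent ℝ (w ∘ i.succAbove)) {x y : Fin (r + 1) → ℝ}
    (h : Fintype.linearCombination ℝ w x = Fintype.linearCombination ℝ w y) :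
    ∃ t : ℝ, y = x + t • μ := by
  set t := (y i - x i) / μ i
  have hi : (y - x - t • μ) i = 0 := by simp [t, hμ]
  have h0 : Fintype.linearCombination ℝ w (y - x - t • μ) = 0 := by
    rw [map_sub, map_sub, map_smul, hrel, h]; simp
  have hz : i.removeNth (y - x - t • μ) = 0 := by
    rw [← insertNth_zero_removeNth hi, linearCombination_insertNth_zero] at h0
    rw [linearIndependent_iff_injective_fintypeLinearCombination] at hli
    exact hli (h0.trans (map_zero _).symm)
  refine ⟨t, ?_⟩
  rw [← sub_eq_zero, ← sub_sub, ← insertNth_zero_removeNth hi, hz]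
  ext j
  refine Fin.succAboveCases i ?_ (fun k => ?_) j <;> simp

lemma image_facet_eq (w : Fin (r + 1) → Fin r → ℝ) (i : Fin (r + 1)) :
    Fintype.linearCombination ℝ (w ∘ i.succAbove) '' cornerSimplex (Fin r) 1 =
      Fintype.linearCombination ℝ w '' {x ∈ cornerSimplex (Fin (r + 1)) 1 | x i = 0} := by
  apply subset_antisymm
  · rintro _ ⟨y, hy, rfl⟩
    refine ⟨i.insertNth 0 y, ⟨⟨fun j => ?_, ?_⟩, by simp⟩, linearCombination_insertNth_zero w i y⟩
    · refine Fin.succAboveCases i ?_ (fun k => ?_) j 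
      · simp
      · simpa using hy.1 k
    · simpa [Fin.sum_univ_succAbove _ i] using hy.2
  · rintro _ ⟨x, ⟨hx, hi⟩, rfl⟩
    refine ⟨i.removeNth x, ⟨fun j => hx.1 _, ?_⟩, ?_⟩
    · have := hx.2
      rw [Fin.sum_univ_succAbove _ i, hi, zero_add] at this
      exact this
    · rw [← linearCombination_insertNth_zero, insertNth_zero_removeNth hi]

/-- The segment from `x` to `y` stays in one fibre of `f`, and along it the coordinate sum crosses
`1`. -/
lemma mem_image_stdSimplex_of_one_le_sum {ι E : Type*} [Fintype ι] [AddCommGroup E] [Module ℝ E]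
    (f : (ι → ℝ) →ₗ[ℝ] E) {x y : ι → ℝ}
    (hx : x ∈ cornerSimplex ι 1) (hy : 0 ≤ y) (hy1 : 1 ≤ ∑ i, y i) (h : f x = f y) :
    f x ∈ f '' stdSimplex ℝ ι := by
  rcases hx.2.eq_or_lt with hx1 | hx1
  · exact ⟨x, ⟨hx.1, hx1⟩, rfl⟩
  set a := ∑ i, x i
  set b := ∑ i, y i
  have hab : 0 < b - a := by linarith
  have h1 : 0 ≤ (b - 1) / (b - a) := div_nonneg (by linarith) hab.le
  have h2 : 0 ≤ (1 - a) / (b - a) := div_nonneg (by linarith) hab.le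
  refine ⟨((b - 1) / (b - a)) • x + ((1 - a) / (b - a)) • y,
    ⟨fun i => ?_, ?_⟩, ?_⟩
  · exact add_nonneg (mul_nonneg h1 (hx.1 i)) (mul_nonneg h2 (hy i))
  · simp only [Pi.add_apply, Pi.smul_apply, smul_eq_mul, Finset.sum_add_distrib,
      ← Finset.mul_sum]
    change (b - 1) / (b - a) * a + (1 - a) / (b - a) * b = 1
    field_simp
    ring
  · rw [map_add, map_smul, map_smul, ← h, ← add_smul, ← add_div]
    rw [show b - 1 + (1 - a) = b - a by ring, div_self hab.ne', one_smul]

/-- Moving along the relation `μ`, a point of the hull of a circuit and the origin reaches the hull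
of the circuit or a facet opposite to a vector with positive coefficient. -/
lemma image_cornerSimplex_eq_union
    (hrel : Fintype.linearCombination ℝ w μ = 0) (hμ : ∀ i, μ i ≠ 0) :
    Fintype.linearCombination ℝ w '' cornerSimplex (Fin (r + 1)) 1 =
      Fintype.linearCombination ℝ w '' stdSimplex ℝ (Fin (r + 1)) ∪
        ⋃ i ∈ Finset.univ.filter (fun i => 0 < μ i),
          Fintype.linearCombination ℝ (w ∘ i.succAbove) '' cornerSimplex (Fin r) 1 := by
  simp only [image_facet_eq]
  apply subset_antisymm
  · rintro _ ⟨x, hx, rfl⟩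
    have hT (s : ℝ) : Fintype.linearCombination ℝ w x =
        Fintype.linearCombination ℝ w (x - s • μ) := by
      rw [map_sub, map_smul, hrel]; simp
    by_cases hP : (Finset.univ.filter (fun i => 0 < μ i)).Nonempty
    -- The minimal ratio is the largest `s` for which `x - s • μ` is still nonnegative; there
    -- coordinate `i` vanishes.
    · obtain ⟨i, hi, hmin⟩ := Finset.exists_min_image _ (fun i => x i / μ i) hP
      simp only [Finset.mem_filter, Finset.mem_univ, true_and] at hi hmin
      have hs : 0 ≤ x i / μ i := div_nonneg (hx.1 i) hi.le
      have hy : 0 ≤ x - (x i / μ i) • μ := by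
        intro j
        have hxj : 0 ≤ x j := hx.1 j
        change 0 ≤ x j - x i / μ i * μ j
        rcases lt_or_gt_of_ne (hμ j) with hj | hj
        · nlinarith
        · have := hmin j hj
          rw [le_div_iff₀ hj] at this
          linarith
      rcases le_total (∑ j, (x - (x i / μ i) • μ) j) 1 with h1 | h1
      · right
        rw [Set.mem_iUnion₂]
        refine ⟨i, by simpa using hi, _, ⟨⟨hy, h1⟩, ?_⟩, (hT _).symm⟩
        simp [hi.ne']
      · exact Or.inl (mem_image_stdSimplex_of_one_le_sum _ hx hy h1 (hT _))
    · left
      have hneg (j) : μ j < 0 := by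
        rcases lt_or_gt_of_ne (hμ j) with hj | hj
        · exact hj
        · exact absurd ⟨j, by simpa using hj⟩ hP
      -- With all coefficients negative, this step length raises coordinate `0` by exactly `1`,
      -- which forces the coordinate sum to be at least `1`.
      have hneg' : 0 ≤ (-μ 0)⁻¹ := inv_nonneg.2 (by linarith [hneg 0])
      have h0 (j) : 0 ≤ (x - (-μ 0)⁻¹ • μ) j := by
        change 0 ≤ x j - (-μ 0)⁻¹ * μ j
        have hxj : 0 ≤ x j := hx.1 j
        nlinarith [hneg j]
      refine mem_image_stdSimplex_of_one_le_sum _ hx h0 ?_ (hT (-μ 0)⁻¹)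
      refine le_trans ?_ (Finset.single_le_sum (fun j _ => h0 j) (Finset.mem_univ 0))
      change 1 ≤ x 0 - (-μ 0)⁻¹ * μ 0
      have hx0 : 0 ≤ x 0 := hx.1 0
      have : (-μ 0)⁻¹ * μ 0 = -1 := by have := hμ 0; field_simp
      linarith
  · refine Set.union_subset (Set.image_mono fun x hx => ⟨hx.1, hx.2.le⟩) ?_
    exact Set.iUnion₂_subset fun i _ => Set.image_mono fun x hx => hx.1

/-- The hull of a circuit and the origin is, up to null sets, the disjoint union of the hull of the
circuit and of the facets opposite to the vectors with positive coefficient. -/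
lemma volume_convexHull_insert_zero_circuit
    (hrel : Fintype.linearCombination ℝ w μ = 0) (hμ : ∀ i, μ i ≠ 0) (hsum : ∑ i, μ i ≤ 0)
    (hli : ∀ i : Fin (r + 1), LinearIndependent ℝ (w ∘ i.succAbove)) :
    volume (convexHull ℝ (insert 0 (Set.range w))) =
      volume (convexHull ℝ (Set.range w)) +
        ∑ i with 0 < μ i, volume (convexHull ℝ (insert 0 (Set.range (w ∘ i.succAbove)))) := by
  have hker {x y : Fin (r + 1) → ℝ}
      (h : Fintype.linearCombination ℝ w x = Fintype.linearCombination ℝ w y) :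
      ∃ t : ℝ, y = x + t • μ :=
    exists_eq_add_smul_of_linearCombination_eq hrel (hμ 0) (hli 0) h
  have hmeas (i : Fin (r + 1)) : MeasurableSet
      (Fintype.linearCombination ℝ (w ∘ i.succAbove) '' cornerSimplex (Fin r) 1) :=
    ((isCompact_cornerSimplex _ 1).image
      (LinearMap.continuous_of_finiteDimensional _)).measurableSet
  simp only [← image_cornerSimplex_eq_convexHull, ← image_stdSimplex_eq_convexHull]
  rw [image_cornerSimplex_eq_union hrel hμ, measure_union₀, measure_biUnion_finset₀]
  -- For a common point of two facets, the two representations differ by `t • μ`. Coordinate `i`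
  -- gives `t ≤ 0`, and coordinate `k` then forces `y k' = 0`.
  · intro i hi k hk hik
    simp only [Finset.coe_filter, Finset.mem_univ, true_and, Set.mem_ofPred_eq] at hi hk
    obtain ⟨k', rfl⟩ := Fin.exists_succAbove_eq hik.symm
    refine measure_mono_null ?_ (volume_image_levelSet_eq_zero
      (Fintype.linearCombination ℝ (w ∘ i.succAbove)) (LinearMap.proj k') (c := 0)
      ⟨fun _ => 1, by simp⟩)
    rintro _ ⟨⟨y, hy, rfl⟩, hz⟩
    refine ⟨y, ?_, rfl⟩
    beta_reduce at hz
    rw [image_facet_eq] at hz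
    obtain ⟨x, ⟨hx, hxk⟩, hxy⟩ := hz
    rw [← linearCombination_insertNth_zero] at hxy
    obtain ⟨t, ht⟩ := hker hxy
    have h1 := congrFun ht i
    have h2 := congrFun ht (i.succAbove k')
    have hy' : 0 ≤ y k' := hy.1 k'
    have hx' : 0 ≤ x i := hx.1 i
    simp [hxk] at h1 h2
    change y k' = 0
    have : t ≤ 0 := by nlinarith
    nlinarith
  · exact fun i _ => (hmeas i).nullMeasurableSet
  · exact (Finset.measurableSet_biUnion _ fun i _ => hmeas i).nullMeasurableSet
  -- Here coordinate `i` gives `t ≥ 0`; since `∑ μ ≤ 0`, the facet point must already have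
  -- coordinate sum `1`.
  · rw [AEDisjoint, Set.inter_iUnion₂]
    refine measure_iUnion_null fun i => measure_iUnion_null fun hi => ?_
    simp only [Finset.mem_filter, Finset.mem_univ, true_and] at hi
    refine measure_mono_null ?_ (volume_image_levelSet_eq_zero
      (Fintype.linearCombination ℝ (w ∘ i.succAbove)) (∑ k, LinearMap.proj k) (c := 1)
      ⟨0, by simp⟩)
    rintro _ ⟨⟨x, hx, rfl⟩, ⟨y, hy, hyx⟩⟩
    refine ⟨y, ?_, hyx⟩
    rw [← linearCombination_insertNth_zero] at hyx
    obtain ⟨t, ht⟩ := hker hyx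
    have h1 := congrFun ht i
    have h2 : ∑ j, x j = ∑ j, y j + t * ∑ j, μ j := by
      rw [ht]
      simp only [Fin.sum_univ_succAbove _ i, Pi.add_apply, Pi.smul_apply, smul_eq_mul,
        Fin.insertNth_apply_same, Fin.insertNth_apply_succAbove, Finset.sum_add_distrib,
        ← Finset.mul_sum]
      ring
    have hx' : 0 ≤ x i := hx.1 i
    simp at h1
    have ht0 : 0 ≤ t := by by_contra! h; nlinarith
    have := hx.2
    have hy1 := hy.2
    simp only [Set.mem_ofPred_eq, LinearMap.sum_apply, LinearMap.proj_apply]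
    nlinarith

end Circuit

/-! ### Lattice indices and integral circuits -/

/-- `K/H` is cyclic, generated by the class of `x`, with annihilator `gℤ`. This computes both the
minors of a circuit and the index `i(P, β)`. -/
lemma AddSubgroup.relIndex_eq_natAbs_of_sup_zmultiples {G : Type*} [AddCommGroup G]
    {H K : AddSubgroup G} {x : G} {g : ℤ} (hK : H ⊔ AddSubgroup.zmultiples x = K)
    (hg : ∀ k : ℤ, k • x ∈ H ↔ g ∣ k) : H.relIndex K = g.natAbs := by
  rw [← hK, AddSubgroup.relIndex_sup_left, ← AddSubgroup.range_zmultiplesHom,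
    ← AddSubgroup.index_comap, ← Int.index_zmultiples]
  congr 1
  ext k
  simp [hg, Int.mem_zmultiples_iff]

section IntegralCircuit

variable {r : ℕ} {w : Fin (r + 1) → Fin r → ℤ} {μ : Fin (r + 1) → ℤ}

lemma linearIndependent_comp_succAbove_of_circuit
    (hker : ∀ c : Fin (r + 1) → ℤ, ∑ i, c i • w i = 0 ↔ ∃ k : ℤ, c = k • μ)
    {i : Fin (r + 1)} (hμ : μ i ≠ 0) : LinearIndependent ℤ (w ∘ i.succAbove) := by
  rw [Fintype.linearIndependent_iff]
  intro c hc
  obtain ⟨k, hk⟩ := (hker (i.insertNth 0 c)).1 (by simpa [Fin.sum_univ_succAbove _ i] using hc)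
  have hi := congrFun hk i
  have hk0 : k = 0 := by simpa [hμ] using hi.symm
  intro j
  have := congrFun hk (i.succAbove j)
  simpa [hk0] using this

/-- The maximal minors of an integral circuit are, up to sign, the coefficients of its primitive
relation. -/
lemma natAbs_det_of_circuit (hspan : Submodule.span ℤ (Set.range w) = ⊤)
    (hker : ∀ c : Fin (r + 1) → ℤ, ∑ i, c i • w i = 0 ↔ ∃ k : ℤ, c = k • μ)
    {i : Fin (r + 1)} (hμ : μ i ≠ 0) :
    (Matrix.of (w ∘ i.succAbove)).det.natAbs = (μ i).natAbs := by
  have hli := linearIndependent_comp_succAbove_of_circuit hker hμ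
  set N := Submodule.span ℤ (Set.range (w ∘ i.succAbove)) with hN
  have h1 : N.toAddSubgroup.index = (Matrix.of (w ∘ i.succAbove)).det.natAbs := by
    rw [AddSubgroup.index_eq_natAbs_det (Pi.basisFun ℤ (Fin r)) N.toAddSubgroup
      (Module.Basis.span hli), Pi.basisFun_det]
    congr 2
    ext j k
    exact congrFun (congrArg Subtype.val (Module.Basis.span_apply hli j)) k
  rw [← h1, ← AddSubgroup.relIndex_top_right]
  -- The quotient by the span of the other vectors is generated by `w i`, and `k • w i` dies there
  -- exactly when `μ i ∣ k`.
  refine AddSubgroup.relIndex_eq_natAbs_of_sup_zmultiples (x := w i) ?_ fun k => ?_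
  · rw [eq_top_iff]
    have : (⊤ : Submodule ℤ (Fin r → ℤ)) ≤ N ⊔ Submodule.span ℤ {w i} := by
      rw [← hspan, Submodule.span_le]
      rintro _ ⟨j, rfl⟩
      refine Fin.succAboveCases i ?_ (fun k => ?_) j
      · exact Submodule.mem_sup_right (Submodule.mem_span_singleton_self _)
      · exact Submodule.mem_sup_left (Submodule.subset_span ⟨k, rfl⟩)
    intro x _
    obtain ⟨y, hy, z, hz, rfl⟩ := Submodule.mem_sup.1 (this (Submodule.mem_top (x := x)))
    obtain ⟨t, rfl⟩ := Submodule.mem_span_singleton.1 hz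
    exact AddSubgroup.mem_sup.2 ⟨y, hy, _, ⟨t, rfl⟩, rfl⟩
  · rw [Submodule.mem_toAddSubgroup, hN, Submodule.mem_span_range_iff_exists_fun]
    constructor
    · rintro ⟨c, hc⟩
      obtain ⟨t, ht⟩ := (hker (i.insertNth (-k) c)).1 (by
        simp only [Function.comp_apply] at hc
        rw [Fin.sum_univ_succAbove _ i]
        simp only [Fin.insertNth_apply_same, Fin.insertNth_apply_succAbove]
        rw [hc, neg_smul, neg_add_cancel])
      have := congrFun ht i
      exact ⟨-t, by simp at this; linarith⟩
    · rintro ⟨t, rfl⟩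
      refine ⟨fun j => -t * μ (i.succAbove j), ?_⟩
      have := (hker (t • μ)).2 ⟨t, rfl⟩
      rw [Fin.sum_univ_succAbove _ i] at this
      simp only [Pi.smul_apply, smul_eq_mul] at this
      simp only [Function.comp_apply, neg_mul, neg_smul, Finset.sum_neg_distrib]
      rw [mul_comm]
      exact (eq_neg_of_add_eq_zero_left this).symm

lemma min_sum_abs_eq {ι : Type*} [Fintype ι] {μ : ι → ℤ} (h : ∑ i, μ i ≤ 0) :
    min (∑ i with 0 < μ i, |(μ i : ℝ)|) (∑ i with μ i < 0, |(μ i : ℝ)|) =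
      ∑ i with 0 < μ i, |(μ i : ℝ)| := by
  apply min_eq_left
  rw [← sub_nonpos, Finset.sum_filter, Finset.sum_filter, ← Finset.sum_sub_distrib]
  have : ∑ i, (μ i : ℝ) ≤ 0 := by exact_mod_cast h
  refine (Finset.sum_congr rfl fun i _ => ?_).trans_le this
  rcases lt_trichotomy (μ i) 0 with h | h | h
  · have h' : (μ i : ℝ) < 0 := by exact_mod_cast h
    simp [h, h.le.not_gt, abs_of_neg h']
  · simp [h]
  · have h' : 0 < (μ i : ℝ) := by exact_mod_cast h
    simp [h, h.le.not_gt, abs_of_pos h']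

lemma volume_sub_volume_of_circuit_of_sum_nonpos (hspan : Submodule.span ℤ (Set.range w) = ⊤)
    (hker : ∀ c : Fin (r + 1) → ℤ, ∑ i, c i • w i = 0 ↔ ∃ k : ℤ, c = k • μ)
    (hμ : ∀ i, μ i ≠ 0) (hsum : ∑ i, μ i ≤ 0) :
    (r.factorial : ℝ) * (volume (convexHull ℝ
        (insert 0 (Set.range fun (i : Fin (r + 1)) (j : Fin r) => (w i j : ℝ))))).toReal -
      r.factorial * (volume (convexHull ℝ
        (Set.range fun (i : Fin (r + 1)) (j : Fin r) => (w i j : ℝ)))).toReal =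
      min (∑ i with 0 < μ i, |(μ i : ℝ)|) (∑ i with μ i < 0, |(μ i : ℝ)|) := by
  set W : Fin (r + 1) → Fin r → ℝ := fun i j => (w i j : ℝ) with hW
  have hdet (i : Fin (r + 1)) : |(Matrix.of (W ∘ i.succAbove)).det| = |(μ i : ℝ)| := by
    have h1 : Matrix.of (W ∘ i.succAbove) =
        (Matrix.of (w ∘ i.succAbove)).map (Int.castRingHom ℝ) := rfl
    have h2 := natAbs_det_of_circuit hspan hker (hμ i)
    rw [h1, ← RingHom.mapMatrix_apply, ← RingHom.map_det, eq_intCast, ← Int.cast_abs,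
      ← Int.cast_abs, Int.abs_eq_natAbs, Int.abs_eq_natAbs, h2]
  have hli (i : Fin (r + 1)) : LinearIndependent ℝ (W ∘ i.succAbove) := by
    refine Matrix.linearIndependent_rows_of_det_ne_zero (A := Matrix.of (W ∘ i.succAbove)) ?_
    rw [← abs_ne_zero, hdet, abs_ne_zero]
    exact_mod_cast hμ i
  have hrel : Fintype.linearCombination ℝ W (fun i => (μ i : ℝ)) = 0 := by
    have := (hker μ).2 ⟨1, by simp⟩
    ext j
    have hj := congrFun this j
    simp only [Finset.sum_apply, Pi.smul_apply, smul_eq_mul, Pi.zero_apply] at hj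
    simp only [Fintype.linearCombination_apply, Finset.sum_apply, Pi.smul_apply, smul_eq_mul, hW,
      Pi.zero_apply]
    exact_mod_cast hj
  have hvol := volume_convexHull_insert_zero_circuit hrel (fun i => by exact_mod_cast hμ i)
    (by exact_mod_cast hsum) hli
  have hfacet (i : Fin (r + 1)) :
      volume (convexHull ℝ (insert 0 (Set.range (W ∘ i.succAbove)))) =
        ENNReal.ofReal (|(μ i : ℝ)| / r.factorial) := by
    rw [← hdet, ← volume_convexHull_insert_zero]
    rfl
  have hfin : volume (convexHull ℝ (Set.range W)) ≠ ⊤ :=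
    ((Set.finite_range W).isCompact_convexHull ℝ).measure_lt_top.ne
  rw [hvol, ENNReal.toReal_add hfin (by simp [hfacet]), mul_add, add_sub_cancel_left,
    min_sum_abs_eq hsum, ENNReal.toReal_sum (by simp [hfacet]), Finset.mul_sum]
  have hf : (r.factorial : ℝ) ≠ 0 := by positivity
  refine Finset.sum_congr ?_ fun i _ => ?_
  · ext i; simp
  · rw [hfacet, ENNReal.toReal_ofReal (by positivity), mul_div_cancel₀ _ hf]

lemma volume_sub_volume_of_circuit (hspan : Submodule.span ℤ (Set.range w) = ⊤)
    (hker : ∀ c : Fin (r + 1) → ℤ, ∑ i, c i • w i = 0 ↔ ∃ k : ℤ, c = k • μ)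
    (hμ : ∀ i, μ i ≠ 0) :
    (r.factorial : ℝ) * (volume (convexHull ℝ
        (insert 0 (Set.range fun (i : Fin (r + 1)) (j : Fin r) => (w i j : ℝ))))).toReal -
      r.factorial * (volume (convexHull ℝ
        (Set.range fun (i : Fin (r + 1)) (j : Fin r) => (w i j : ℝ)))).toReal =
      min (∑ i with 0 < μ i, |(μ i : ℝ)|) (∑ i with μ i < 0, |(μ i : ℝ)|) := by
  rcases le_total (∑ i, μ i) 0 with h | h
  · exact volume_sub_volume_of_circuit_of_sum_nonpos hspan hker hμ h
  -- The relation matters only up to sign; reversing it exchanges the two sums.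
  · rw [volume_sub_volume_of_circuit_of_sum_nonpos (μ := -μ) hspan, min_comm]
    · simp
    · intro c
      rw [hker]
      exact ⟨fun ⟨k, hk⟩ => ⟨-k, by simpa using hk⟩, fun ⟨k, hk⟩ => ⟨-k, by simpa using hk⟩⟩
    · simpa using hμ
    · simpa using h

end IntegralCircuit

/-- The subdiagram volume of an integral circuit: if `w` generates the lattice `M` and its relations
are the multiples of `μ`, then adjoining the origin to `w` increases the normalized volume by the
smaller of the sums of the positive and of the negative coefficients of `μ`. -/
lemma ToricGale.normalizedVolume_insert_zero_sub_of_circuit {M ι : Type} [AddCommGroup M]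
    [Module.Free ℤ M] [Module.Finite ℤ M] [Fintype ι] [Nonempty ι] {w : ι → M} {μ : ι → ℤ}
    (hspan : Submodule.span ℤ (Set.range w) = ⊤)
    (hker : ∀ c : ι → ℤ, ∑ i, c i • w i = 0 ↔ ∃ k : ℤ, c = k • μ) (hμ : ∀ i, μ i ≠ 0) :
    normalizedVolume M (insert 0 (Set.range w)) - normalizedVolume M (Set.range w) =
      min (∑ i with 0 < μ i, |(μ i : ℝ)|) (∑ i with μ i < 0, |(μ i : ℝ)|) := by
  set r := Module.finrank ℤ M with hr
  let b := Module.finBasis ℤ M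
  -- Rank-nullity: the relation module is `ℤμ`, of rank one.
  have hcard : Fintype.card ι = r + 1 := by
    have h1 := (LinearMap.ker (Fintype.linearCombination ℤ w)).finrank_quotient_add_finrank
    rw [(LinearMap.quotKerEquivRange _).finrank_eq, Fintype.range_linearCombination, hspan,
      finrank_top, Module.finrank_fintype_fun_eq_card] at h1
    have h2 : LinearMap.ker (Fintype.linearCombination ℤ w) = Submodule.span ℤ {μ} := by
      ext c
      rw [LinearMap.mem_ker, Fintype.linearCombination_apply, hker, Submodule.mem_span_singleton]
      simp only [eq_comm]
    have hμ0 : μ ≠ 0 := fun h => hμ (Classical.arbitrary ι) (congrFun h _)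
    rw [h2, ← (LinearEquiv.toSpanNonzeroSingleton ℤ _ μ hμ0).finrank_eq, Module.finrank_self] at h1
    exact h1.symm
  let e : Fin (r + 1) ≃ ι := (Fintype.equivFinOfCardEq hcard).symm
  let W : Fin (r + 1) → Fin r → ℤ := fun j => b.equivFun (w (e j))
  have hWspan : Submodule.span ℤ (Set.range W) = ⊤ := by
    have : Set.range W = b.equivFun '' Set.range w := by
      rw [← Set.range_comp, ← e.surjective.range_comp]; rfl
    rw [this]
    change Submodule.span ℤ (b.equivFun.toLinearMap '' _) = _
    rw [← Submodule.map_span, hspan, Submodule.map_top, LinearEquiv.range]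
  have hWker (c : Fin (r + 1) → ℤ) : ∑ i, c i • W i = 0 ↔ ∃ k : ℤ, c = k • (μ ∘ e) := by
    have h1 : ∑ i, c i • W i = b.equivFun (∑ i, (c ∘ e.symm) i • w i) := by
      rw [map_sum, ← e.sum_comp]
      simp [W]
    rw [h1, LinearEquiv.map_eq_zero_iff, hker]
    refine exists_congr fun k => ⟨fun h => ?_, fun h => ?_⟩
    · ext j; simpa using congrFun h (e j)
    · ext j; simpa using congrFun h (e.symm j)
  have himage : (fun (x : M) (i : Fin r) => ((b.repr x i : ℤ) : ℝ)) '' Set.range w =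
      Set.range fun (i : Fin (r + 1)) (j : Fin r) => (W i j : ℝ) := by
    rw [← Set.range_comp, ← e.surjective.range_comp]; rfl
  have hzero : (fun (i : Fin r) => ((b.repr (0 : M) i : ℤ) : ℝ)) = 0 := by ext; simp
  have hmain := volume_sub_volume_of_circuit hWspan hWker fun i => hμ (e i)
  unfold normalizedVolume
  rw [Set.image_insert_eq]
  change (r.factorial : ℝ) * (volume (convexHull ℝ (insert
    (fun (i : Fin r) => ((b.repr (0 : M) i : ℤ) : ℝ))
    ((fun (x : M) (i : Fin r) => ((b.repr x i : ℤ) : ℝ)) '' Set.range w)))).toReal -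
    r.factorial * (volume (convexHull ℝ
    ((fun (x : M) (i : Fin r) => ((b.repr x i : ℤ) : ℝ)) '' Set.range w))).toReal = _
  rw [himage, hzero, hmain]
  simp only [Finset.sum_filter, Function.comp_apply]
  rw [e.sum_comp (fun i => if 0 < μ i then |(μ i : ℝ)| else 0),
    e.sum_comp (fun i => if μ i < 0 then |(μ i : ℝ)| else 0)]

/-! ### Clearing denominators, primitive vectors and lattice spans -/

namespace ToricGale

/-- An integer vector in the real span of integer vectors has a nonzero multiple in their integer
span. -/
lemma exists_smul_mem_span_of_castPi_mem_span {d : ℕ} {ι : Type*} [Fintype ι]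
    (S : ι → Fin d → ℤ) {x : Fin d → ℤ}
    (hx : castPi d x ∈ Submodule.span ℝ (Set.range fun j => castPi d (S j))) :
    ∃ N : ℤ, N ≠ 0 ∧ N • x ∈ Submodule.span ℤ (Set.range S) := by
  obtain ⟨t, ht⟩ := (Submodule.mem_span_range_iff_exists_fun ℝ).1 hx
  -- A `ℚ`-linear retraction `ℝ → ℚ` turns the real coefficients into rational ones and fixes the
  -- integer data.
  obtain ⟨φ, hφ⟩ := (Algebra.linearMap ℚ ℝ).exists_leftInverse_of_injective
    (LinearMap.ker_eq_bot.2 (algebraMap ℚ ℝ).injective)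
  have hφ1 (q : ℚ) : φ q = q := LinearMap.congr_fun hφ q
  obtain ⟨N, hN⟩ := IsLocalization.exist_integer_multiples_of_finite (nonZeroDivisors ℤ)
    (fun j => φ (t j))
  choose m hm using hN
  refine ⟨N, nonZeroDivisors.coe_ne_zero N, ?_⟩
  rw [Submodule.mem_span_range_iff_exists_fun]
  refine ⟨m, ?_⟩
  ext i
  have h1 : ∑ j, φ (t j) * (S j i : ℚ) = x i := by
    have h2 : ∑ j, t j * (S j i : ℝ) = x i := by
      have := congrFun ht i
      simpa [castPi] using this
    have h3 := congrArg φ h2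
    rw [map_sum] at h3
    have h4 : φ ((x i : ℤ) : ℝ) = (x i : ℚ) := by
      rw [← Rat.cast_intCast, hφ1]
    rw [h4] at h3
    rw [← h3]
    refine Finset.sum_congr rfl fun j _ => ?_
    rw [mul_comm, mul_comm (t j), ← zsmul_eq_mul, ← zsmul_eq_mul, map_zsmul]
  have h5 : ((∑ j, m j * S j i : ℤ) : ℚ) = ((N : ℤ) * x i : ℤ) := by
    push_cast
    rw [← h1, Finset.mul_sum]
    refine Finset.sum_congr rfl fun j _ => ?_
    have := hm j
    simp only [eq_intCast, zsmul_eq_mul] at this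
    rw [this, mul_assoc]
  have h6 : ∑ j, m j * S j i = (N : ℤ) * x i := by exact_mod_cast h5
  simpa using h6

section Primitive

lemma IsPrimitive.exists_dotProduct_eq_one {v : Fin 2 → ℤ} (hv : IsPrimitive v) :
    ∃ u : Fin 2 → ℤ, v ⬝ᵥ u = 1 := by
  have hg : (Int.gcd (v 0) (v 1) : ℤ) = 1 ∨ (Int.gcd (v 0) (v 1) : ℤ) = -1 := by
    refine hv _ ![v 0 / Int.gcd (v 0) (v 1), v 1 / Int.gcd (v 0) (v 1)] ?_
    ext i
    fin_cases i
    · exact (Int.mul_ediv_cancel' (Int.gcd_dvd_left ..)).symm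
    · exact (Int.mul_ediv_cancel' (Int.gcd_dvd_right ..)).symm
  have h1 : Int.gcd (v 0) (v 1) = 1 := by omega
  obtain ⟨a, b, hab⟩ := Int.isCoprime_iff_gcd_eq_one.2 h1
  exact ⟨![a, b], by simp [dotProduct, Fin.sum_univ_two]; linarith⟩

/-- Pairing `b = c v` with `u` gives `c = b·u`, so the real factor is an integer. -/
lemma eq_dotProduct_smul_of_mem_line {v u b : Fin 2 → ℤ} (huv : v ⬝ᵥ u = 1)
    {L : Submodule ℝ (Fin 2 → ℝ)} (hL : Module.finrank ℝ L = 1)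
    (hv : (fun j => (v j : ℝ)) ∈ L) (hb : (fun j => (b j : ℝ)) ∈ L) :
    b = (b ⬝ᵥ u) • v := by
  have hv0 : (⟨_, hv⟩ : L) ≠ 0 := by
    intro h
    have h0 : v = 0 := by
      ext j
      have := congrFun (congrArg Subtype.val h) j
      simpa using this
    simp [h0] at huv
  obtain ⟨c, hc⟩ := (finrank_eq_one_iff_of_nonzero' _ hv0).1 hL ⟨_, hb⟩
  have hc' (j) : (b j : ℝ) = c * v j := (congrFun (congrArg Subtype.val hc) j).symm
  have h1 : (v 0 : ℝ) * u 0 + v 1 * u 1 = 1 := by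
    rw [dotProduct, Fin.sum_univ_two] at huv
    exact_mod_cast huv
  ext j
  have : (b j : ℝ) = (b 0 * u 0 + b 1 * u 1) * v j := by
    rw [hc' 0, hc' 1, hc' j]
    linear_combination (-c * v j) * h1
  rw [Pi.smul_apply, dotProduct, Fin.sum_univ_two, smul_eq_mul]
  exact_mod_cast this

end Primitive

variable {d n : ℕ} {A : Matrix (Fin d) (Fin n) ℤ} {β : Set (Fin d → ℝ)}

lemma mem_offFace {j : Fin n} : j ∈ offFace A β ↔ realCol A j ∉ β := by
  simp [offFace]

lemma realCol_mem_polytope (A : Matrix (Fin d) (Fin n) ℤ) (j : Fin n) :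
    realCol A j ∈ polytope A :=
  subset_convexHull ℝ _ ⟨j, rfl⟩

lemma mulVec_eq_sum_smul_col (A : Matrix (Fin d) (Fin n) ℤ) (z : Fin n → ℤ) :
    A.mulVec z = ∑ j, z j • A.col j := by
  ext i
  simp [Matrix.mulVec, dotProduct, mul_comm]

lemma col_mem_latticeSpan {j : Fin n} (hj : realCol A j ∈ β) : A.col j ∈ latticeSpan A β :=
  Submodule.subset_span ⟨j, hj, rfl⟩

lemma latticeSpan_polytope (A : Matrix (Fin d) (Fin n) ℤ) :
    latticeSpan A (polytope A) = Submodule.span ℤ (Set.range A.col) := by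
  rw [latticeSpan]
  congr 1
  ext x
  simp [realCol_mem_polytope, eq_comm]

lemma latticeSpan_eq_span_range (A : Matrix (Fin d) (Fin n) ℤ) (β : Set (Fin d → ℝ)) :
    latticeSpan A β =
      Submodule.span ℤ (Set.range fun j : {j // realCol A j ∈ β} => A.col j) := by
  rw [latticeSpan]
  congr 1
  ext x
  simp [eq_comm]

lemma latticeSpan_mono {α β : Set (Fin d → ℝ)} (h : ∀ j, realCol A j ∈ β → realCol A j ∈ α) :
    latticeSpan A β ≤ latticeSpan A α :=
  Submodule.span_mono fun _ ⟨j, hj, hx⟩ => ⟨j, h j hj, hx⟩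

lemma latticeSpan_le_realSpan (A : Matrix (Fin d) (Fin n) ℤ) (β : Set (Fin d → ℝ)) :
    latticeSpan A β ≤ realSpan β := by
  rw [latticeSpan, Submodule.span_le]
  rintro _ ⟨j, hj, rfl⟩
  exact Submodule.subset_span (s := β) hj

lemma mem_realSpan_of_smul_mem {x : Fin d → ℤ} {c : ℤ} (hc : c ≠ 0)
    (h : c • x ∈ realSpan β) : x ∈ realSpan β := by
  have h' : (c : ℝ) • castPi d x ∈ Submodule.span ℝ β := by
    have h2 : castPi d (c • x) ∈ Submodule.span ℝ β := h
    rwa [map_smul, ← Int.cast_smul_eq_zsmul ℝ] at h2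
  exact ((Submodule.span ℝ β).smul_mem_iff (Int.cast_ne_zero.mpr hc)).mp h'

/-! ### Faces of the polytope -/

section Face

/-- A nonempty face of the polytope is cut out by a linear functional which is nonnegative on the
columns. -/
lemma exists_face_functional (hA : IsToricMatrix A) (hβ : IsExposed ℝ (polytope A) β)
    (hne : β.Nonempty) :
    ∃ f : (Fin d → ℝ) →ₗ[ℝ] ℝ, (∀ j, 0 ≤ f (realCol A j)) ∧
      (∀ j, f (realCol A j) = 0 ↔ realCol A j ∈ β) ∧ ∀ x ∈ β, f x = 0 := by
  obtain ⟨l, hl⟩ := hβ hne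
  obtain ⟨x₀, hx₀⟩ := hne
  obtain ⟨c, hc⟩ := hA.ones_mem_rowSpace
  let h : (Fin d → ℝ) →ₗ[ℝ] ℝ := ∑ i, (c i : ℝ) • LinearMap.proj i
  have hcol (j) : h (realCol A j) = 1 := by
    have := hc j
    simp only [h, LinearMap.sum_apply, LinearMap.smul_apply, LinearMap.proj_apply, realCol,
      smul_eq_mul]
    exact_mod_cast this
  have hP (x) (hx : x ∈ polytope A) : h x = 1 := by
    have : polytope A ⊆ {x | h x = 1} :=
      convexHull_min (by rintro _ ⟨j, rfl⟩; exact hcol j) (convex_hyperplane h.isLinear 1)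
    exact this hx
  rw [hl] at hx₀
  -- The row-space functional `h` is `1` on the polytope, so it makes the affine condition `l = l
  -- x₀` linear.
  refine ⟨l x₀ • h - l.toLinearMap, fun j => ?_, fun j => ?_, fun x hx => ?_⟩
  · have := hx₀.2 _ (realCol_mem_polytope A j)
    simp [hcol, this]
  · simp only [LinearMap.sub_apply, LinearMap.smul_apply, hcol, smul_eq_mul, mul_one, sub_eq_zero]
    rw [hl]
    constructor
    · intro he
      exact ⟨realCol_mem_polytope A j, fun y hy => (hx₀.2 y hy).trans he.le⟩
    · exact fun hj => le_antisymm (hj.2 _ hx₀.1) (hx₀.2 _ hj.1)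
  · rw [hl] at hx
    simp only [LinearMap.sub_apply, LinearMap.smul_apply, hP x hx.1, smul_eq_mul, mul_one]
    exact sub_eq_zero.2 (le_antisymm (hx.2 _ hx₀.1) (hx₀.2 _ hx.1))

/-- In a convex combination lying in `β`, the face functional is a sum of nonnegative terms equal to
zero, so columns off `β` carry weight zero. -/
lemma subset_span_columns_of_face (hA : IsToricMatrix A) (hβ : IsExposed ℝ (polytope A) β)
    (hne : β.Nonempty) :
    β ⊆ Submodule.span ℝ (Set.range fun j : {j // realCol A j ∈ β} => castPi d (A.col j)) := by
  obtain ⟨f, hf0, hf1, hf2⟩ := exists_face_functional hA hβ hne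
  intro x hx
  have hxP : x ∈ polytope A := hβ.subset hx
  rw [polytope, ← image_stdSimplex_eq_convexHull] at hxP
  obtain ⟨t, ht, rfl⟩ := hxP
  have h0 := hf2 _ hx
  rw [Fintype.linearCombination_apply] at h0 ⊢
  rw [map_sum, Finset.sum_eq_zero_iff_of_nonneg
    (fun j _ => by rw [map_smul]; exact mul_nonneg (ht.1 j) (hf0 j))] at h0
  refine Submodule.sum_mem _ fun j _ => ?_
  by_cases hj : realCol A j ∈ β
  · exact Submodule.smul_mem _ _ (Submodule.subset_span ⟨⟨j, hj⟩, rfl⟩)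
  · have h1 := h0 j (Finset.mem_univ j)
    rw [map_smul, smul_eq_mul, mul_eq_zero, hf1, or_iff_left hj] at h1
    simp [h1]

lemma exists_smul_mem_latticeSpan (hA : IsToricMatrix A) (hβ : IsExposed ℝ (polytope A) β)
    (hne : β.Nonempty) {x : Fin d → ℤ} (hx : x ∈ realSpan β) :
    ∃ N : ℤ, N ≠ 0 ∧ N • x ∈ latticeSpan A β := by
  classical
  rw [latticeSpan_eq_span_range]
  exact exists_smul_mem_span_of_castPi_mem_span _
    (Submodule.span_le.2 (subset_span_columns_of_face hA hβ hne) hx)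

lemma col_notMem_realSpan (hA : IsToricMatrix A) (hβ : IsExposed ℝ (polytope A) β)
    (hne : β.Nonempty) {j : Fin n} (hj : j ∈ offFace A β) : A.col j ∉ realSpan β := by
  obtain ⟨f, -, hf1, hf2⟩ := exists_face_functional hA hβ hne
  intro h
  have hle : Submodule.span ℝ β ≤ LinearMap.ker f := Submodule.span_le.2 hf2
  exact mem_offFace.1 hj ((hf1 j).1 (hle h))

lemma offFace_nonempty (hβ : IsExposed ℝ (polytope A) β) (hβP : β ≠ polytope A) :
    (offFace A β).Nonempty := by
  by_contra h
  rw [Finset.not_nonempty_iff_eq_empty, Finset.eq_empty_iff_forall_notMem] at h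
  simp only [mem_offFace, not_not] at h
  refine hβP (hβ.subset.antisymm (convexHull_min ?_ (hβ.convex (convex_convexHull ℝ _))))
  rintro _ ⟨j, rfl⟩
  exact h j

end Face

/-! ### Relations modulo a face, via the Gale dual -/

section Gale

variable {B : Matrix (Fin n) (Fin 2) ℤ} {v u : Fin 2 → ℤ} {lam μ : Fin n → ℤ}

lemma IsGaleDual.mulVec_eq_zero_iff {k : ℕ} {B : Matrix (Fin n) (Fin k) ℤ} (hB : IsGaleDual A B)
    (z : Fin n → ℤ) : A.mulVec z = 0 ↔ ∃ y, B.mulVec y = z := by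
  have : z ∈ LinearMap.range B.mulVecLin ↔ z ∈ LinearMap.ker A.mulVecLin := by rw [hB]
  exact this.symm

lemma mulVec_apply_of_row_eq_smul {i : Fin n} {c : ℤ} (h : B.row i = c • v) (y : Fin 2 → ℤ) :
    B.mulVec y i = c * (v ⬝ᵥ y) := by
  change B.row i ⬝ᵥ y = _
  rw [h, smul_dotProduct, smul_eq_mul]

/-- The rows of a Gale dual of a matrix with two more columns than rows are not all parallel. -/
lemma exists_column_mem_face (hn : n = d + 2) (hB : IsGaleDual A B) (hB0 : ∀ i, B.row i ≠ 0)
    (hlam : ∀ i ∈ offFace A β, B.row i = lam i • v) : ∃ j, realCol A j ∈ β := by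
  by_contra! h
  have hrow (i) : B.row i = lam i • v := hlam i (mem_offFace.2 (h i))
  let i₀ : Fin n := ⟨0, by omega⟩
  have hlam0 : lam i₀ ≠ 0 := fun h0 => hB0 i₀ (by rw [hrow, h0, zero_smul])
  -- If all rows were multiples of `v`, a kernel vector would be determined by its entry at `i₀`, so
  -- `F` would embed `ℤ^(d+2)` in `ℤ^(d+1)`.
  let F : (Fin n → ℤ) →ₗ[ℤ] (Fin d → ℤ) × ℤ := A.mulVecLin.prod (LinearMap.proj i₀)
  have hF : Function.Injective F := by
    rw [injective_iff_map_eq_zero]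
    intro z hz
    obtain ⟨hz1, hz2⟩ := Prod.mk.inj hz
    obtain ⟨y, rfl⟩ := (hB.mulVec_eq_zero_iff z).1 hz1
    have h0 : lam i₀ * (v ⬝ᵥ y) = 0 := by rw [← mulVec_apply_of_row_eq_smul (hrow i₀)]; exact hz2
    ext i
    rw [mulVec_apply_of_row_eq_smul (hrow i), (mul_eq_zero.1 h0).resolve_left hlam0, mul_zero]
    rfl
  have := LinearMap.finrank_le_finrank_of_injective hF
  simp at this
  omega

lemma sum_smul_col_mem_latticeSpan_iff (hB : IsGaleDual A B) (huv : v ⬝ᵥ u = 1)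
    (hlam : ∀ i ∈ offFace A β, B.row i = lam i • v) (c : Fin n → ℤ) :
    ∑ i ∈ offFace A β, c i • A.col i ∈ latticeSpan A β ↔
      ∃ k : ℤ, ∀ i ∈ offFace A β, c i = k * lam i := by
  classical
  constructor
  · intro h
    rw [latticeSpan_eq_span_range, Submodule.mem_span_range_iff_exists_fun] at h
    obtain ⟨t, ht⟩ := h
    -- Completing `c` by the negated coefficients on `β` gives an element of `ker A`.
    let z : Fin n → ℤ := fun j => if h : realCol A j ∈ β then -t ⟨j, h⟩ else c j
    have hz : A.mulVec z = 0 := by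
      rw [mulVec_eq_sum_smul_col, ← Finset.sum_add_sum_compl (offFace A β)]
      have h1 : ∑ i ∈ offFace A β, z i • A.col i = ∑ i ∈ offFace A β, c i • A.col i :=
        Finset.sum_congr rfl fun i hi => by simp [z, mem_offFace.1 hi]
      have h2 : ∑ i ∈ (offFace A β)ᶜ, z i • A.col i =
          ∑ j : {j // realCol A j ∈ β}, -(t j • A.col j) := by
        rw [← Finset.sum_subtype (p := fun j => realCol A j ∈ β) (offFace A β)ᶜ
          (fun j => by simp [mem_offFace]) (fun i => z i • A.col i) |>.symm]
        refine Finset.sum_congr rfl fun j _ => ?_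
        simp [z, j.2]
      rw [h1, h2, Finset.sum_neg_distrib, ht, add_neg_cancel]
    obtain ⟨y, hy⟩ := (hB.mulVec_eq_zero_iff z).1 hz
    refine ⟨v ⬝ᵥ y, fun i hi => ?_⟩
    have := congrFun hy i
    rw [mulVec_apply_of_row_eq_smul (hlam i hi)] at this
    rw [mul_comm, this]
    simp [z, mem_offFace.1 hi]
  · rintro ⟨k, hk⟩
    have hz := (hB.mulVec_eq_zero_iff (B.mulVec (k • u))).2 ⟨_, rfl⟩
    rw [mulVec_eq_sum_smul_col, ← Finset.sum_add_sum_compl (offFace A β)] at hz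
    have h1 : ∑ i ∈ offFace A β, c i • A.col i =
        ∑ i ∈ offFace A β, B.mulVec (k • u) i • A.col i := by
      refine Finset.sum_congr rfl fun i hi => ?_
      rw [hk i hi, mulVec_apply_of_row_eq_smul (hlam i hi), dotProduct_smul, huv, smul_eq_mul,
        mul_one, mul_comm]
    rw [h1, eq_neg_of_add_eq_zero_left hz]
    refine neg_mem (Submodule.sum_mem _ fun j hj => Submodule.smul_mem _ _ ?_)
    exact col_mem_latticeSpan (by simpa [mem_offFace] using hj)

lemma sum_smul_col_mem_realSpan_iff (hA : IsToricMatrix A) (hB : IsGaleDual A B)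
    (hβ : IsExposed ℝ (polytope A) β) (hne : β.Nonempty) (huv : v ⬝ᵥ u = 1)
    (hlam : ∀ i ∈ offFace A β, B.row i = lam i • v)
    {g : ℤ} (hg : g ≠ 0) (hμ : ∀ i ∈ offFace A β, lam i = g * μ i)
    (hgcd : (offFace A β).gcd μ = 1) (c : Fin n → ℤ) :
    ∑ i ∈ offFace A β, c i • A.col i ∈ realSpan β ↔
      ∃ k : ℤ, ∀ i ∈ offFace A β, c i = k * μ i := by
  have key (N : ℤ) : N • ∑ i ∈ offFace A β, c i • A.col i ∈ latticeSpan A β ↔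
      ∃ k : ℤ, ∀ i ∈ offFace A β, N * c i = k * (g * μ i) := by
    have := sum_smul_col_mem_latticeSpan_iff hB huv hlam (fun i => N * c i)
    simp only [mul_smul, ← Finset.smul_sum] at this
    rw [this]
    exact exists_congr fun k => forall₂_congr fun i hi => by rw [hμ i hi]
  constructor
  · intro h
    obtain ⟨N, hN, hmem⟩ := exists_smul_mem_latticeSpan hA hβ hne h
    obtain ⟨k, hk⟩ := (key N).1 hmem
    -- `N` divides every `k g μ_i`, and the `μ_i` have gcd `1`.
    have hdvd : N ∣ k * g := by
      have h1 : N ∣ (offFace A β).gcd fun i => k * g * μ i :=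
        Finset.dvd_gcd fun i hi => ⟨c i, by rw [hk i hi, mul_assoc]⟩
      rw [Finset.gcd_mul_left, hgcd, mul_one] at h1
      exact dvd_normalize_iff.1 h1
    obtain ⟨m, hm⟩ := hdvd
    refine ⟨m, fun i hi => mul_left_cancel₀ hN ?_⟩
    rw [hk i hi, ← mul_assoc, hm, mul_assoc]
  · rintro ⟨k, hk⟩
    refine mem_realSpan_of_smul_mem hg (latticeSpan_le_realSpan A β ((key g).2 ⟨k, fun i hi => ?_⟩))
    rw [hk i hi]; ring

/-- The element `x = ∑ μ_i a_i` generates `ℤA ∩ ℝβ` over `ℤβ`, and `k • x` lies in `ℤβ` exactly when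
`kμ` is a multiple of `λ = gμ`. -/
lemma latticeIndex_eq_natAbs (hB : IsGaleDual A B) (huv : v ⬝ᵥ u = 1)
    (hlam : ∀ i ∈ offFace A β, B.row i = lam i • v)
    {g : ℤ} (hμ : ∀ i ∈ offFace A β, lam i = g * μ i) (hμ0 : ∃ i ∈ offFace A β, μ i ≠ 0)
    (hreal : ∀ c : Fin n → ℤ, ∑ i ∈ offFace A β, c i • A.col i ∈ realSpan β ↔
      ∃ k : ℤ, ∀ i ∈ offFace A β, c i = k * μ i) :
    latticeIndex A (polytope A) β = g.natAbs := by
  classical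
  have hmono : latticeSpan A β ≤ latticeSpan A (polytope A) :=
    latticeSpan_mono fun j _ => realCol_mem_polytope A j
  set x : Fin d → ℤ := ∑ i ∈ offFace A β, μ i • A.col i with hx
  refine AddSubgroup.relIndex_eq_natAbs_of_sup_zmultiples (x := x) ?_ fun k => ?_
  · apply le_antisymm
    · refine sup_le (fun y hy => ⟨hmono hy, latticeSpan_le_realSpan A β hy⟩) ?_
      rw [AddSubgroup.zmultiples_le]
      refine ⟨Submodule.sum_mem _ fun i _ => Submodule.smul_mem _ _
        (col_mem_latticeSpan (realCol_mem_polytope A i)), (hreal μ).2 ⟨1, by simp⟩⟩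
    · rintro y ⟨hy1, hy2⟩
      have hy1' : y ∈ latticeSpan A (polytope A) := hy1
      rw [latticeSpan_polytope, Submodule.mem_span_range_iff_exists_fun] at hy1'
      obtain ⟨c, rfl⟩ := hy1'
      rw [← Finset.sum_add_sum_compl (offFace A β)] at hy2 ⊢
      have h2 : ∑ i ∈ (offFace A β)ᶜ, c i • A.col i ∈ latticeSpan A β :=
        Submodule.sum_mem _ fun j hj => Submodule.smul_mem _ _
          (col_mem_latticeSpan (by simpa [mem_offFace] using hj))
      obtain ⟨k, hk⟩ := (hreal c).1
        (((realSpan β).add_mem_iff_left (latticeSpan_le_realSpan A β h2)).1 hy2)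
      rw [add_comm]
      refine AddSubgroup.mem_sup.2 ⟨_, h2, k • x, ⟨k, rfl⟩, ?_⟩
      congr 1
      rw [hx, Finset.smul_sum]
      exact Finset.sum_congr rfl fun i hi => by rw [hk i hi, mul_smul]
  · have := sum_smul_col_mem_latticeSpan_iff hB huv hlam (fun i => k * μ i)
    simp only [mul_smul, ← Finset.smul_sum] at this
    rw [Submodule.mem_toAddSubgroup, hx, this]
    constructor
    · rintro ⟨m, hm⟩
      obtain ⟨i, hi, hi0⟩ := hμ0
      refine ⟨m, mul_right_cancel₀ hi0 ?_⟩
      rw [hm i hi, hμ i hi]; ring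
    · rintro ⟨m, rfl⟩
      exact ⟨m, fun i hi => by rw [hμ i hi]; ring⟩

end Gale

/-! ### The quotient lattice as an integral circuit -/

/-- The image of the column `a_j` in the quotient lattice `ℤA / (ℤA ∩ ℝβ)`. -/
def quotientColumn (A : Matrix (Fin d) (Fin n) ℤ) (β : Set (Fin d → ℝ)) (j : Fin n) :
    QuotientLattice A (polytope A) β :=
  Submodule.Quotient.mk ⟨A.col j, col_mem_latticeSpan (realCol_mem_polytope A j)⟩

lemma quotientColumn_eq_zero_iff (j : Fin n) :
    quotientColumn A β j = 0 ↔ A.col j ∈ realSpan β := by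
  rw [quotientColumn, Submodule.Quotient.mk_eq_zero]
  rfl

lemma quotientColumn_eq_zero {j : Fin n} (hj : realCol A j ∈ β) : quotientColumn A β j = 0 :=
  (quotientColumn_eq_zero_iff j).2 (latticeSpan_le_realSpan A β (col_mem_latticeSpan hj))

lemma sum_smul_quotientColumn_eq_zero_iff (c : offFace A β → ℤ) :
    ∑ i, c i • quotientColumn A β i = 0 ↔ ∑ i, c i • A.col i ∈ realSpan β := by
  have : ∑ i, c i • quotientColumn A β i = Submodule.Quotient.mk
      (∑ i, c i • ⟨A.col i, col_mem_latticeSpan (realCol_mem_polytope A i)⟩) := by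
    rw [← Submodule.mkQ_apply, map_sum]
    rfl
  rw [this, Submodule.Quotient.mk_eq_zero]
  change (latticeSpan A (polytope A)).subtype _ ∈ realSpan β ↔ _
  rw [map_sum]
  rfl

lemma span_range_quotientColumn (A : Matrix (Fin d) (Fin n) ℤ) (β : Set (Fin d → ℝ)) :
    Submodule.span ℤ (Set.range fun i : offFace A β => quotientColumn A β i) = ⊤ := by
  rw [eq_top_iff]
  rintro x -
  obtain ⟨⟨y, hy⟩, rfl⟩ := Submodule.Quotient.mk_surjective _ x
  have hy' := hy
  rw [latticeSpan_polytope, Submodule.mem_span_range_iff_exists_fun] at hy'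
  obtain ⟨c, rfl⟩ := hy'
  have : (Submodule.Quotient.mk ⟨∑ i, c i • A.col i, hy⟩ : QuotientLattice A (polytope A) β) =
      ∑ j, c j • quotientColumn A β j := by
    have h1 : (⟨∑ i, c i • A.col i, hy⟩ : latticeSpan A (polytope A)) =
        ∑ i, c i • ⟨A.col i, col_mem_latticeSpan (realCol_mem_polytope A i)⟩ := by
      ext1
      change _ = (latticeSpan A (polytope A)).subtype _
      rw [map_sum]
      rfl
    rw [h1, ← Submodule.mkQ_apply, map_sum]
    rfl
  rw [this]
  refine Submodule.sum_mem _ fun j _ => Submodule.smul_mem _ _ ?_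
  by_cases hj : realCol A j ∈ β
  · rw [quotientColumn_eq_zero hj]
    exact Submodule.zero_mem _
  · exact Submodule.subset_span ⟨⟨j, mem_offFace.2 hj⟩, rfl⟩

lemma quotientPoints_eq_insert (hj : ∃ j, realCol A j ∈ β) :
    quotientPoints A (polytope A) β =
      insert 0 (Set.range fun i : offFace A β => quotientColumn A β i) := by
  ext x
  constructor
  · rintro ⟨j, y, -, hy, rfl⟩
    have h1 : (Submodule.Quotient.mk y : QuotientLattice A (polytope A) β) =
        quotientColumn A β j := by
      congr 1
      exact Subtype.ext hy
    rw [h1]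
    by_cases h : realCol A j ∈ β
    · exact Or.inl (quotientColumn_eq_zero h)
    · exact Or.inr ⟨⟨j, mem_offFace.2 h⟩, rfl⟩
  · rintro (rfl | ⟨i, rfl⟩)
    · obtain ⟨j, hj⟩ := hj
      exact ⟨j, _, realCol_mem_polytope A j, rfl, (quotientColumn_eq_zero hj).symm⟩
    · exact ⟨i, _, realCol_mem_polytope A i, rfl, rfl⟩

lemma subdiagramVolume_eq_min_sum (hA : IsToricMatrix A) (hβ : IsExposed ℝ (polytope A) β)
    (hβP : β ≠ polytope A) (hj : ∃ j, realCol A j ∈ β) {μ : Fin n → ℤ}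
    (hμ0 : ∀ i ∈ offFace A β, μ i ≠ 0)
    (hreal : ∀ c : Fin n → ℤ, ∑ i ∈ offFace A β, c i • A.col i ∈ realSpan β ↔
      ∃ k : ℤ, ∀ i ∈ offFace A β, c i = k * μ i) :
    subdiagramVolume A (polytope A) β =
      min (∑ i ∈ offFace A β with 0 < μ i, |(μ i : ℝ)|)
        (∑ i ∈ offFace A β with μ i < 0, |(μ i : ℝ)|) := by
  classical
  have hne : β.Nonempty := let ⟨j, hj⟩ := hj; ⟨_, hj⟩
  -- Only columns in `β` map to the origin, so deleting it leaves exactly the circuit.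
  have hzero : (0 : QuotientLattice A (polytope A) β) ∉
      Set.range fun i : offFace A β => quotientColumn A β i := by
    rintro ⟨i, hi⟩
    exact col_notMem_realSpan hA hβ hne i.2 ((quotientColumn_eq_zero_iff _).1 hi)
  have hker (c : offFace A β → ℤ) : ∑ i, c i • quotientColumn A β i = 0 ↔
      ∃ k : ℤ, c = k • fun i : offFace A β => μ i := by
    rw [sum_smul_quotientColumn_eq_zero_iff]
    let c' : Fin n → ℤ := fun j => if h : j ∈ offFace A β then c ⟨j, h⟩ else 0
    have hc' (i : offFace A β) : c' i = c i := by simp [c']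
    have h1 : ∑ i, c i • A.col i = ∑ i ∈ offFace A β, c' i • A.col i := by
      rw [← Finset.sum_coe_sort (offFace A β)]
      exact Finset.sum_congr rfl fun i _ => by rw [hc']
    rw [h1, hreal]
    refine exists_congr fun k => ⟨fun h => ?_, fun h i hi => ?_⟩
    · ext i
      rw [← hc', h i i.2]
      rfl
    · rw [hc' ⟨i, hi⟩, h]
      rfl
  have : Nonempty (offFace A β) := (offFace_nonempty hβ hβP).to_subtype
  rw [subdiagramVolume, quotientPoints_eq_insert hj, Set.insert_sdiff_self_of_notMem hzero,
    normalizedVolume_insert_zero_sub_of_circuit (span_range_quotientColumn A β) hker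
      fun i => hμ0 i i.2]
  simp only [Finset.sum_filter]
  rw [Finset.sum_coe_sort (offFace A β) (fun i => if 0 < μ i then |(μ i : ℝ)| else 0),
    Finset.sum_coe_sort (offFace A β) (fun i => if μ i < 0 then |(μ i : ℝ)| else 0)]

end ToricGale

/-! ### Rescaling by the gcd and conclusion -/

lemma min_sum_abs_eq_mul_min_sum_abs {ι : Type*} (s : Finset ι) {lam μ : ι → ℤ} {g : ℤ}
    (hg : 0 < g) (h : ∀ i ∈ s, lam i = g * μ i) :
    min (∑ i ∈ s with 0 < lam i, |(lam i : ℝ)|) (∑ i ∈ s with lam i < 0, |(lam i : ℝ)|) =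
      g * min (∑ i ∈ s with 0 < μ i, |(μ i : ℝ)|) (∑ i ∈ s with μ i < 0, |(μ i : ℝ)|) := by
  have hg' : (0 : ℝ) < g := by exact_mod_cast hg
  rw [mul_min_of_nonneg _ _ hg'.le]
  simp only [Finset.sum_filter, Finset.mul_sum]
  congr 1 <;> refine Finset.sum_congr rfl fun i hi => ?_ <;> rw [h i hi] <;>
    simp [abs_mul, abs_of_pos hg', hg, mul_pos_iff_of_pos_left, mul_neg_iff, hg.le.not_gt]

open ToricGale

theorem mainTheorem2 {d n : ℕ} (hn : n = d + 2)
    (A : Matrix (Fin d) (Fin n) ℤ) (hA : ToricGale.IsToricMatrix A)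
    (B : Matrix (Fin n) (Fin 2) ℤ) (hB : ToricGale.IsGaleDual A B)
    (hB0 : ∀ i, B.row i ≠ 0)
    (β : Set (Fin d → ℝ)) (hβ : IsExposed ℝ (ToricGale.polytope A) β)
    (hβP : β ≠ ToricGale.polytope A)
    (L : Submodule ℝ (Fin 2 → ℝ)) (hL : ToricGale.IsRelevantLine B L)
    (hβL : ∀ i ∈ ToricGale.offFace A β, ToricGale.realRow B i ∈ L)
    (v : Fin 2 → ℤ) (hv : ToricGale.IsPrimitive v) (hvL : (fun j => (v j : ℝ)) ∈ L) :
    ∃ lam : Fin n → ℤ,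
      (∀ i ∈ ToricGale.offFace A β, B.row i = lam i • v) ∧
      ToricGale.subdiagramVolume A (ToricGale.polytope A) β =
        min (∑ i ∈ ToricGale.offFace A β with 0 < lam i, |(lam i : ℝ)|)
            (∑ i ∈ ToricGale.offFace A β with lam i < 0, |(lam i : ℝ)|) /
          (((ToricGale.offFace A β).gcd lam : ℤ) : ℝ) ∧
      (ToricGale.latticeIndex A (ToricGale.polytope A) β : ℤ) =
        (ToricGale.offFace A β).gcd lam := by
  obtain ⟨u, huv⟩ := hv.exists_dotProduct_eq_one
  let lam : Fin n → ℤ := fun i => B.row i ⬝ᵥ u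
  have hlam : ∀ i ∈ offFace A β, B.row i = lam i • v := fun i hi =>
    eq_dotProduct_smul_of_mem_line huv hL.1 hvL (hβL i hi)
  have hlam0 : ∀ i ∈ offFace A β, lam i ≠ 0 := fun i hi h0 =>
    hB0 i (by rw [hlam i hi, h0, zero_smul])
  -- An exposed face may be empty; this rules that out.
  have hj := exists_column_mem_face hn hB hB0 hlam
  have hne : β.Nonempty := let ⟨j, hj⟩ := hj; ⟨_, hj⟩
  have hI := offFace_nonempty hβ hβP
  obtain ⟨μ, hμ, hgcd⟩ := Finset.extract_gcd lam hI
  set g := (offFace A β).gcd lam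
  obtain ⟨i₀, hi₀⟩ := hI
  have hg0 : g ≠ 0 := fun h => hlam0 i₀ hi₀ (by rw [hμ i₀ hi₀, h, zero_mul])
  have hgpos : 0 < g :=
    lt_of_le_of_ne (Int.nonneg_of_normalize_eq_self Finset.normalize_gcd) hg0.symm
  have hμ0 : ∀ i ∈ offFace A β, μ i ≠ 0 := fun i hi h =>
    hlam0 i hi (by rw [hμ i hi, h, mul_zero])
  have hreal := sum_smul_col_mem_realSpan_iff hA hB hβ hne huv hlam hg0 hμ hgcd
  refine ⟨lam, hlam, ?_, ?_⟩
  · rw [subdiagramVolume_eq_min_sum hA hβ hβP hj hμ0 hreal,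
      min_sum_abs_eq_mul_min_sum_abs _ hgpos hμ,
      mul_div_cancel_left₀ _ (by exact_mod_cast hg0)]
  · rw [latticeIndex_eq_natAbs hB huv hlam hμ ⟨i₀, hi₀, hμ0 i₀ hi₀⟩ hreal, Int.natCast_natAbs,
      abs_of_pos hgpos]
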